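/- Theorem 1. Words are infinite words $x_1x_2x_3\cdots$ over finite alphabets of non-negative integers. In the alternate (Ito–Sadahiro) order, $x \prec y$ means that there is $k \ge 1$ with $x_i = y_i$ for all $i < k$ and $(-1)^k (x_k - y_k) < 0$; $x \preceq y$ means $x = y$ or $x \prec y$. Let $(d_i)_{i\ge1}$ be an alternate Lyndon word, i.e. $d_1d_2d_3\cdots \preceq d_nd_{n+1}d_{n+2}\cdots$ for all $n \ge 1$, and let $M$ be the associated Lyndon system, i.e. the set of infinite words $x_1x_2\cdots$ over $\{0,1,\dots,d_1\}$ such that $d_1d_2\cdots \preceq x_nx_{n+1}\cdots$ for all $n\ge1$. Let $H_n$ be the number of words of length $n$ that occur as blocks of consecutive letters in elements of $M$, and let the (topological) entropy of $M$ be $\lim_{n\to\infty}\frac1n\log H_n$ (this limit exists). Let $\phi$ be the morphism of words over $\{0,1\}$ with $\phi(0)=1$ and $\phi(1)=100$, let $\phi^\infty(1)=\lim_{n\to\infty}\phi^n(1)=100111001001001110011\cdots$ be the infinite word having every $\phi^n(1)$ as a prefix, and write $\overline{w}=www\cdots$ for a non-empty finite word $w$. Then: (a) $M$ has positive entropy if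 and only if $(d_i)_{i\ge1} \prec \phi^\infty(1)$. (b) $M$ has zero entropy if and only if $(d_i)_{i\ge1} \in \{\overline{0},\ \phi^\infty(1)\} \cup \{\overline{\phi^n(1)} : n \in \mathbb{N}\}$, where $\mathbb{N}=\{0,1,2,\dots\}$. -/

import Mathlib

/-! Infinite words `x₁ x₂ x₃ ⋯` over the non-negative integers are functions `x : ℕ → ℕ`;
the letter written `x₁` on paper is `x 0`, and generally `xₖ` is `x (k - 1)`. -/

namespace AltLyndon

/-- The strict alternate (Ito–Sadahiro) order: `x ≺ y` if at the first (1-based) index `k` at which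
they differ, `(-1)^k (x_k - y_k) < 0`.  (The 1-based index of `x k` is `k + 1`.) -/
def AltLT (x y : ℕ → ℕ) : Prop :=
  ∃ k : ℕ, (∀ i < k, x i = y i) ∧ (-1 : ℤ) ^ (k + 1) * ((x k : ℤ) - (y k : ℤ)) < 0

/-- The alternate order `x ⪯ y`. -/
def AltLE (x y : ℕ → ℕ) : Prop :=
  x = y ∨ AltLT x y

/-- The suffix of `x` obtained by deleting its first `n` letters, `σⁿ x`. -/
def suffix (n : ℕ) (x : ℕ → ℕ) : ℕ → ℕ :=
  fun i => x (n + i)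

/-- `d` is an alternate Lyndon word: it is `⪯` each of its suffixes. -/
def IsAltLyndon (d : ℕ → ℕ) : Prop :=
  ∀ n : ℕ, AltLE d (suffix n d)

/-- The Lyndon system `M` of `d`: the infinite words over the alphabet `{0, 1, …, d₁}` all of whose
suffixes are `⪰ d`. -/
def lyndonSystem (d : ℕ → ℕ) : Set (ℕ → ℕ) :=
  {x | (∀ i, x i ≤ d 0) ∧ ∀ n : ℕ, AltLE d (suffix n x)}

/-- The words of length `n` of the language of a set `M` of infinite words: the blocks of `n`
consecutive letters that occur in elements of `M`. -/
def language (M : Set (ℕ → ℕ)) (n : ℕ) : Set (Fin n → ℕ) :=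
  {w | ∃ x ∈ M, ∃ k : ℕ, ∀ i : Fin n, w i = x (k + i)}

/-- `(1 / n) log H_n`, with `H_n` the number of words of length `n` of the language of `M`. -/
noncomputable def growth (M : Set (ℕ → ℕ)) (n : ℕ) : ℝ :=
  Real.log ((language M n).ncard : ℝ) / (n : ℝ)

/-- The topological entropy `lim (1 / n) log H_n` of the system `M`. -/
noncomputable def entropy (M : Set (ℕ → ℕ)) : ℝ :=
  Filter.limUnder Filter.atTop (growth M)

/-- The images of the letters under `φ`: `φ(0) = 1`, `φ(1) = 100`. -/
def phiLetter : Fin 2 → List (Fin 2) :=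
  ![[1], [1, 0, 0]]

/-- The morphism `φ` on finite words over `{0, 1}`. -/
def phi (w : List (Fin 2)) : List (Fin 2) :=
  w.flatMap phiLetter

/-- The finite word `φⁿ(1)`. -/
def phiPow (n : ℕ) : List (Fin 2) :=
  phi^[n] [1]

/-- The infinite periodic word `w w w ⋯` (`w` non-empty). -/
def periodicWord (w : List (Fin 2)) : ℕ → ℕ :=
  fun k => ((w.getD (k % w.length) 0 : Fin 2) : ℕ)

/-- The infinite word `φ^∞(1) = lim φⁿ(1)`; `phiInf_eq` below shows that it has every `φⁿ(1)`
as a prefix. -/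
def phiInf : ℕ → ℕ :=
  fun k => (((phiPow k).getD k 0 : Fin 2) : ℕ)

theorem phiPow_succ (n : ℕ) : phiPow (n + 1) = phi (phiPow n) :=
  Function.iterate_succ_apply' phi n [1]

theorem phiPow_prefix_succ (n : ℕ) : phiPow n <+: phiPow (n + 1) := by
  induction n with
  | zero => exact ⟨[0, 0], rfl⟩
  | succ n ih =>
    obtain ⟨t, ht⟩ := ih
    refine ⟨phi t, ?_⟩
    rw [phiPow_succ (n + 1), ← ht]
    have e : phi (phiPow n ++ t) = phi (phiPow n) ++ phi t := List.flatMap_append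
    rw [e, ← phiPow_succ, ht]

theorem phiPow_prefix {m n : ℕ} (h : m ≤ n) : phiPow m <+: phiPow n := by
  induction n, h using Nat.le_induction with
  | base => exact List.prefix_rfl
  | succ n _ ih => exact ih.trans (phiPow_prefix_succ n)

theorem length_le_phi (w : List (Fin 2)) : w.length ≤ (phi w).length := by
  induction w with
  | nil => simp
  | cons a w ih =>
    have h : 1 ≤ (phiLetter a).length := by fin_cases a <;> simp [phiLetter]
    have e : phi (a :: w) = phiLetter a ++ phi w := rfl
    rw [e, List.length_append, List.length_cons]
    omega

theorem lt_length_phiPow (n : ℕ) : n < (phiPow n).length := by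
  induction n with
  | zero => simp [phiPow]
  | succ n ih =>
    obtain ⟨t, ht⟩ := phiPow_prefix (Nat.zero_le n)
    have e : phiPow (n + 1) = [1, 0, 0] ++ phi t := by
      rw [phiPow_succ, ← ht]; rfl
    have h1 := length_le_phi t
    have h2 : (phiPow n).length = 1 + t.length := by
      rw [← ht, List.length_append]; rfl
    rw [e, List.length_append]
    simp only [List.length_cons, List.length_nil]
    omega

/-- Every `φⁿ(1)` is a prefix of `φ^∞(1)`. -/
theorem phiInf_eq (n k : ℕ) (hk : k < (phiPow n).length) :
    phiInf k = (((phiPow n)[k] : Fin 2) : ℕ) := by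
  have hk' := lt_length_phiPow k
  have e : (phiPow k)[k] = (phiPow n)[k] := by
    rcases le_total k n with h | h
    · exact (phiPow_prefix h).getElem hk'
    · exact ((phiPow_prefix h).getElem hk).symm
  rw [phiInf, List.getD_eq_getElem _ _ hk', e]

end AltLyndon

namespace AltLyndon

/-! ### The alternate order -/

/-! Both `φ(0) = 1` and `φ(1) = 100` have odd length, so `φ` preserves the parity of positions and
hence the alternate order on binary words (`AltLT.image_subst`). Everything is a renormalisation by
`φ`, whose fixed point is `φ^∞(1)`.

Below `φ^∞(1)`: the word `1010⋯` is the least binary word, and `φⁿ(1010⋯)` agrees with `φ^∞(1)` on a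
prefix that grows with `n`. So `d ≺ φ^∞(1)` gives `d ≺ φⁿ(1010⋯)` for some `n`, and then `M`
contains the `φⁿ`-image of every binary word (`iterate_subst_mem_lyndonSystem`). As `φⁿ` is
injective and stretches lengths by at most `3ⁿ`, the entropy is at least `log 2 / 3ⁿ`.

At `φ^∞(1)`: a word of the system that is not identically zero is `0^k φ(y)` with `y` again in the
system. Desubstituting twice gives `H_{3n} ≤ (3n+1)² H_n` (`ncard_language_phiInf_le`), so the
entropy `h` satisfies `h ≤ h/3` and vanishes. Since `M` shrinks as `d` increases, the entropy is
zero for all `d ⪰ φ^∞(1)`.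

The Lyndon words `d ⪰ φ^∞(1)` are listed by `IsAltLyndon.classification`: such a `d` starting with
`1` is either `111⋯` or `φ(e)` with `e` of the same kind. Either the descent stops, and `d` is some
`φⁿ(1)` repeated, or it never stops, and `d = φ^∞(1)`. -/

theorem suffix_zero (x : ℕ → ℕ) : suffix 0 x = x := by
  funext i; simp [suffix]

theorem suffix_suffix (m n : ℕ) (x : ℕ → ℕ) : suffix m (suffix n x) = suffix (n + m) x := by
  funext i; simp [suffix, add_assoc]

theorem word_ext {x y : ℕ → ℕ} (h0 : x 0 = y 0) (h : suffix 1 x = suffix 1 y) : x = y := by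
  funext i
  cases i with
  | zero => exact h0
  | succ i => simpa [suffix, add_comm] using congrFun h i

theorem AltLT.irrefl (x : ℕ → ℕ) : ¬ AltLT x x := by
  rintro ⟨k, -, h⟩
  simp at h

theorem AltLT.trans {x y z : ℕ → ℕ} (h1 : AltLT x y) (h2 : AltLT y z) : AltLT x z := by
  obtain ⟨k, hk, hk'⟩ := h1
  obtain ⟨l, hl, hl'⟩ := h2
  rcases lt_trichotomy k l with h | h | h
  · exact ⟨k, fun i hi => (hk i hi).trans (hl i (hi.trans h)), by rw [← hl k h]; exact hk'⟩
  · subst h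
    refine ⟨k, fun i hi => (hk i hi).trans (hl i hi), ?_⟩
    linear_combination hk' + hl'
  · exact ⟨l, fun i hi => (hk i (hi.trans h)).trans (hl i hi), by rw [hk l h]; exact hl'⟩

theorem altLT_trichotomy (x y : ℕ → ℕ) : AltLT x y ∨ x = y ∨ AltLT y x := by
  classical
  by_cases h : x = y
  · exact Or.inr (Or.inl h)
  have hne : ∃ k, x k ≠ y k := Function.ne_iff.mp h
  have hk := Nat.find_spec hne
  have hmin : ∀ i < Nat.find hne, x i = y i := fun i hi => not_not.mp (Nat.find_min hne hi)
  generalize Nat.find hne = k at hk hmin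
  have hk' : (x k : ℤ) ≠ y k := by exact_mod_cast hk
  rcases neg_one_pow_eq_or ℤ (k + 1) with e | e <;> rcases lt_or_gt_of_ne hk' with l | l
  · exact Or.inl ⟨k, hmin, by rw [e]; linarith⟩
  · exact Or.inr (Or.inr ⟨k, fun i hi => (hmin i hi).symm, by rw [e]; linarith⟩)
  · exact Or.inr (Or.inr ⟨k, fun i hi => (hmin i hi).symm, by rw [e]; linarith⟩)
  · exact Or.inl ⟨k, hmin, by rw [e]; linarith⟩

theorem AltLE.refl (x : ℕ → ℕ) : AltLE x x := Or.inl rfl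

theorem AltLE.trans {x y z : ℕ → ℕ} (h1 : AltLE x y) (h2 : AltLE y z) : AltLE x z := by
  rcases h1 with rfl | h1
  · exact h2
  · rcases h2 with rfl | h2
    · exact Or.inr h1
    · exact Or.inr (h1.trans h2)

theorem altLE_iff_not_altLT {x y : ℕ → ℕ} : AltLE x y ↔ ¬ AltLT y x := by
  constructor
  · rintro (rfl | h) h'
    · exact AltLT.irrefl _ h'
    · exact AltLT.irrefl _ (h.trans h')
  · intro h
    rcases altLT_trichotomy x y with h' | h' | h'
    · exact Or.inr h'
    · exact Or.inl h'
    · exact absurd h' h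

/-- Deleting the first letter shifts every index by one and flips the sign, so tails compare in
reversed order. This is the form used in the inductions on words. -/
theorem altLT_iff_head_tail {x y : ℕ → ℕ} :
    AltLT x y ↔ y 0 < x 0 ∨ (x 0 = y 0 ∧ AltLT (suffix 1 y) (suffix 1 x)) := by
  constructor
  · rintro ⟨k, hk, h⟩
    cases k with
    | zero => left; simpa using h
    | succ k =>
      refine Or.inr ⟨hk 0 (Nat.succ_pos k), k, fun i hi => ?_, ?_⟩
      · simpa [suffix, add_comm] using (hk (i + 1) (by omega)).symm
      · simp only [suffix, add_comm 1 k]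
        rw [pow_succ] at h
        linarith
  · rintro (h | ⟨h0, k, hk, h⟩)
    · exact ⟨0, by simp, by simpa using h⟩
    · refine ⟨k + 1, fun i hi => ?_, ?_⟩
      · cases i with
        | zero => exact h0
        | succ i => simpa [suffix, add_comm] using (hk i (by omega)).symm
      · simp only [suffix, add_comm 1 k] at h
        rw [pow_succ]
        linarith

theorem altLE_iff_head_tail {x y : ℕ → ℕ} :
    AltLE x y ↔ y 0 < x 0 ∨ (x 0 = y 0 ∧ AltLE (suffix 1 y) (suffix 1 x)) := by
  constructor
  · rintro (rfl | h)
    · exact Or.inr ⟨rfl, AltLE.refl _⟩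
    · rcases altLT_iff_head_tail.mp h with h | ⟨h0, h⟩
      · exact Or.inl h
      · exact Or.inr ⟨h0, Or.inr h⟩
  · rintro (h | ⟨h0, h | h⟩)
    · exact Or.inr (altLT_iff_head_tail.mpr (Or.inl h))
    · exact Or.inl (word_ext h0 h.symm)
    · exact Or.inr (altLT_iff_head_tail.mpr (Or.inr ⟨h0, h⟩))

theorem AltLE.head_le {x y : ℕ → ℕ} (h : AltLE x y) : y 0 ≤ x 0 := by
  rcases altLE_iff_head_tail.mp h with h | ⟨h, -⟩
  · exact h.le
  · exact h.ge

/-- At odd (1-based) positions the larger letter is the smaller in the order, at even positions the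
reverse, so `1010⋯` makes the least choice everywhere. -/
theorem altLE_alternating {x : ℕ → ℕ} (hx : ∀ i, x i ≤ 1) : AltLE (fun k => (k + 1) % 2) x := by
  rw [altLE_iff_not_altLT]
  rintro ⟨k, -, h⟩
  have hk := hx k
  rcases Nat.even_or_odd k with e | e
  · have h1 : (k + 1) % 2 = 1 := by have := Nat.even_iff.mp e; omega
    simp only [h1, e.add_one.neg_one_pow] at h
    push_cast at h
    omega
  · have h1 : (k + 1) % 2 = 0 := by have := Nat.odd_iff.mp e; omega
    simp only [h1, e.add_one.neg_one_pow] at h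
    push_cast at h
    omega

/-! ### The substitution on infinite words -/

/-- The letters of the image of an infinite word under `φ`; non-zero letters are treated as `1`. -/
def substAux : ℕ → (ℕ → ℕ) → ℕ
  | 0, _ => 1
  | 1, x => if x 0 = 0 then substAux 0 (suffix 1 x) else 0
  | 2, x => if x 0 = 0 then substAux 1 (suffix 1 x) else 0
  | n + 3, x => if x 0 = 0 then substAux (n + 2) (suffix 1 x) else substAux n (suffix 1 x)

/-- The morphism `φ` on infinite words. -/
def subst (x : ℕ → ℕ) : ℕ → ℕ := fun n => substAux n x

theorem subst_zero (x : ℕ → ℕ) : subst x 0 = 1 := by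
  simp [subst, substAux]

theorem suffix_one_subst {x : ℕ → ℕ} (h : x 0 = 0) : suffix 1 (subst x) = subst (suffix 1 x) := by
  funext n
  simp only [suffix, subst, add_comm 1 n]
  match n with
  | 0 => simp [substAux, h]
  | 1 => simp [substAux, h]
  | n + 2 => simp [substAux, h]

theorem suffix_three_subst {x : ℕ → ℕ} (h : x 0 ≠ 0) :
    suffix 3 (subst x) = subst (suffix 1 x) := by
  funext n
  simp only [suffix, subst, add_comm 3 n]
  simp [substAux, h]

theorem subst_one {x : ℕ → ℕ} (h : x 0 ≠ 0) : subst x 1 = 0 := by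
  simp [subst, substAux, h]

theorem subst_two {x : ℕ → ℕ} (h : x 0 ≠ 0) : subst x 2 = 0 := by
  simp [subst, substAux, h]

theorem subst_le_one (x : ℕ → ℕ) (n : ℕ) : subst x n ≤ 1 := by
  unfold subst
  induction n using Nat.strong_induction_on generalizing x with
  | _ n ih =>
    match n with
    | 0 => simp [substAux]
    | 1 => unfold substAux; split_ifs; exacts [ih 0 (by omega) _, zero_le_one]
    | 2 => unfold substAux; split_ifs; exacts [ih 1 (by omega) _, zero_le_one]
    | n + 3 => unfold substAux; split_ifs; exacts [ih _ (by omega) _, ih _ (by omega) _]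

theorem altLT_of_suffix_three {x y : ℕ → ℕ} (h0 : x 0 = y 0) (h1 : x 1 = y 1) (h2 : x 2 = y 2)
    (h : AltLT (suffix 3 y) (suffix 3 x)) : AltLT x y := by
  refine altLT_iff_head_tail.mpr (Or.inr ⟨h0, altLT_iff_head_tail.mpr (Or.inr ⟨h1.symm, ?_⟩)⟩)
  refine altLT_iff_head_tail.mpr (Or.inr ⟨h2, ?_⟩)
  simpa only [suffix_suffix] using h

theorem AltLT.image_subst {x y : ℕ → ℕ} (hx : ∀ i, x i ≤ 1) (hy : ∀ i, y i ≤ 1) (h : AltLT x y) :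
    AltLT (subst x) (subst y) := by
  obtain ⟨k, hk⟩ := h
  induction k generalizing x y with
  | zero =>
    have h0 : y 0 < x 0 := by simpa using hk.2
    have hx0 := hx 0
    have hx1 : x 0 ≠ 0 := by omega
    have hy1 : y 0 = 0 := by omega
    -- Both images start with `1`; the second letter is `0` in `100` but `1` after the block `1`,
    -- and decides.
    refine altLT_iff_head_tail.mpr (Or.inr ⟨by simp [subst_zero], ?_⟩)
    refine altLT_iff_head_tail.mpr (Or.inl ?_)
    rw [suffix_one_subst hy1, subst_zero]
    simp [suffix, subst_one hx1]
  | succ k ih =>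
    have h0 : x 0 = y 0 := hk.1 0 (Nat.succ_pos k)
    -- The tails are swapped; stripping the common block, of odd length 1 or 3, swaps them back.
    have key : AltLT (subst (suffix 1 y)) (subst (suffix 1 x)) := by
      refine ih (fun i => hy _) (fun i => hx _) ⟨fun i hi => ?_, ?_⟩
      · simpa [suffix, add_comm] using (hk.1 (i + 1) (by omega)).symm
      · have h := hk.2
        simp only [suffix, add_comm 1 k]
        rw [pow_succ] at h
        linarith
    by_cases hx0 : x 0 = 0
    · refine altLT_iff_head_tail.mpr (Or.inr ⟨by simp [subst_zero], ?_⟩)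
      rwa [suffix_one_subst hx0, suffix_one_subst (h0 ▸ hx0)]
    · have hy0 : y 0 ≠ 0 := h0 ▸ hx0
      refine altLT_of_suffix_three (by simp [subst_zero]) (by rw [subst_one hx0, subst_one hy0])
        (by rw [subst_two hx0, subst_two hy0]) ?_
      rwa [suffix_three_subst hx0, suffix_three_subst hy0]

theorem subst_altLE_subst {x y : ℕ → ℕ} (hx : ∀ i, x i ≤ 1) (hy : ∀ i, y i ≤ 1) :
    AltLE (subst x) (subst y) ↔ AltLE x y := by
  constructor
  · intro h
    rw [altLE_iff_not_altLT] at h ⊢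
    exact fun h' => h (h'.image_subst hy hx)
  · rintro (rfl | h)
    · exact AltLE.refl _
    · exact Or.inr (h.image_subst hx hy)

/-- A suffix of `φ(x)` either starts with a `0` inside a block `100`, and then exceeds any word
starting with `1`, or starts at a block boundary, and then is `φ` of a suffix of `x`. -/
theorem subst_altLE_suffix_subst {u x : ℕ → ℕ} (hu : ∀ i, u i ≤ 1) (hx : ∀ i, x i ≤ 1)
    (h : ∀ n, AltLE u (suffix n x)) (n : ℕ) : AltLE (subst u) (suffix n (subst x)) := by
  induction n using Nat.strong_induction_on generalizing x with
  | _ n ih =>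
    rcases Nat.eq_zero_or_pos n with rfl | hn
    · rw [suffix_zero, subst_altLE_subst hu hx]
      simpa [suffix_zero] using h 0
    have hs : ∀ m, AltLE u (suffix m (suffix 1 x)) := fun m => by
      rw [suffix_suffix]; exact h _
    by_cases hx0 : x 0 = 0
    · obtain ⟨m, rfl⟩ := Nat.exists_eq_add_of_le hn
      rw [← suffix_suffix m 1, suffix_one_subst hx0]
      exact ih m (by omega) (fun i => hx _) hs
    · rcases lt_or_ge n 3 with h3 | h3
      · refine altLE_iff_head_tail.mpr (Or.inl ?_)
        rw [subst_zero]
        have : n = 1 ∨ n = 2 := by omega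
        rcases this with rfl | rfl
        · simp [suffix, subst_one hx0]
        · simp [suffix, subst_two hx0]
      · obtain ⟨m, rfl⟩ := Nat.exists_eq_add_of_le h3
        rw [← suffix_suffix m 3, suffix_three_subst hx0]
        exact ih m (by omega) (fun i => hx _) hs

/-! ### Prepending a finite word -/

/-- The infinite word `w x`. -/
def prepend : List (Fin 2) → (ℕ → ℕ) → ℕ → ℕ
  | [], x => x
  | a :: w, x => fun i => i.casesOn (a : ℕ) (prepend w x)

theorem prepend_of_lt (w : List (Fin 2)) (x : ℕ → ℕ) (i : ℕ) (h : i < w.length) :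
    prepend w x i = w[i] := by
  induction w generalizing i with
  | nil => simp at h
  | cons a w ih =>
    cases i with
    | zero => rfl
    | succ i => exact ih i (by simpa using h)

theorem prepend_add (w : List (Fin 2)) (x : ℕ → ℕ) (i : ℕ) :
    prepend w x (w.length + i) = x i := by
  induction w with
  | nil => simp [prepend]
  | cons a w ih =>
    rw [List.length_cons, Nat.add_right_comm]
    exact ih

theorem prepend_append (v w : List (Fin 2)) (x : ℕ → ℕ) :
    prepend (v ++ w) x = prepend v (prepend w x) := by
  induction v with
  | nil => rfl
  | cons a v ih => rw [List.cons_append, prepend, prepend, ih]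

theorem eq_prepend {w : List (Fin 2)} {x : ℕ → ℕ}
    (h : ∀ i (hi : i < w.length), x i = w[i]) : x = prepend w (suffix w.length x) := by
  funext i
  rcases lt_or_ge i w.length with hi | hi
  · rw [prepend_of_lt _ _ _ hi, h i hi]
  · obtain ⟨j, rfl⟩ := Nat.exists_eq_add_of_le hi
    rw [prepend_add, suffix]

theorem suffix_one_prepend_cons (a : Fin 2) (w : List (Fin 2)) (x : ℕ → ℕ) :
    suffix 1 (prepend (a :: w) x) = prepend w x := by
  funext i
  simp only [suffix, add_comm 1 i]
  rfl

theorem subst_prepend (w : List (Fin 2)) (x : ℕ → ℕ) :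
    subst (prepend w x) = prepend (phi w) (subst x) := by
  induction w with
  | nil => rfl
  | cons a w ih =>
    have e : phi (a :: w) = phiLetter a ++ phi w := rfl
    rw [e, prepend_append, ← ih]
    have h0 : prepend (a :: w) x 0 = (a : ℕ) := rfl
    fin_cases a
    · have h := suffix_one_subst (x := prepend (0 :: w) x) rfl
      rw [suffix_one_prepend_cons] at h
      refine word_ext (subst_zero _) (h.trans ?_)
      exact (suffix_one_prepend_cons 1 [] _).symm
    · have h1 : prepend (1 :: w) x 0 ≠ 0 := one_ne_zero
      have h := suffix_three_subst h1
      rw [suffix_one_prepend_cons] at h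
      refine word_ext (subst_zero _) (word_ext (subst_one h1) (word_ext (subst_two h1) ?_))
      simp only [suffix_suffix]
      refine h.trans ?_
      funext i
      exact (prepend_add [1, 0, 0] _ i).symm

theorem iterate_subst_prepend (n : ℕ) (x : ℕ → ℕ) :
    subst^[n] (prepend [1] x) = prepend (phiPow n) (subst^[n] x) := by
  induction n with
  | zero => rfl
  | succ n ih =>
    rw [Function.iterate_succ_apply', ih, subst_prepend, phiPow_succ,
      Function.iterate_succ_apply' subst]

theorem phiInf_eq_prepend (n : ℕ) :
    phiInf = prepend (phiPow n) (suffix (phiPow n).length phiInf) :=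
  eq_prepend fun i hi => phiInf_eq n i hi

theorem prepend_phiPow_apply {n k : ℕ} (h : k ≤ n) (x : ℕ → ℕ) :
    prepend (phiPow n) x k = phiInf k := by
  have hk : k < (phiPow n).length := h.trans_lt (lt_length_phiPow n)
  rw [prepend_of_lt _ _ _ hk, phiInf_eq n k hk]

theorem subst_phiInf : subst phiInf = phiInf := by
  funext k
  rw [phiInf_eq_prepend k, subst_prepend, ← phiPow_succ, prepend_phiPow_apply (Nat.le_succ k),
    prepend_phiPow_apply le_rfl]

theorem phiInf_le_one (k : ℕ) : phiInf k ≤ 1 := by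
  rw [← subst_phiInf]; exact subst_le_one _ _

theorem phiInf_values : phiInf 0 = 1 ∧ phiInf 1 = 0 ∧ phiInf 2 = 0 ∧ phiInf 3 = 1 := by
  have h0 : phiInf 0 = 1 := by rw [← subst_phiInf, subst_zero]
  have h : phiInf 0 ≠ 0 := by omega
  refine ⟨h0, ?_, ?_, ?_⟩
  · rw [← subst_phiInf, subst_one h]
  · rw [← subst_phiInf, subst_two h]
  · have := congrFun (suffix_three_subst h) 0
    rw [subst_phiInf, subst_zero] at this
    exact this

theorem periodicWord_le_one (w : List (Fin 2)) (k : ℕ) : periodicWord w k ≤ 1 :=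
  Nat.le_of_lt_succ (Fin.is_lt _)

theorem periodicWord_eq_prepend (w : List (Fin 2)) :
    periodicWord w = prepend w (periodicWord w) := by
  refine (eq_prepend (w := w) fun i hi => ?_).trans ?_
  · rw [periodicWord, Nat.mod_eq_of_lt hi, List.getD_eq_getElem _ _ hi]
  · congr 1
    funext i
    simp [suffix, periodicWord]

theorem eq_periodicWord {w : List (Fin 2)} (hw : w ≠ []) {x : ℕ → ℕ} (hx : x = prepend w x) :
    x = periodicWord w := by
  have hlen : 0 < w.length := List.length_pos_iff.mpr hw
  funext i
  induction i using Nat.strong_induction_on with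
  | _ i ih =>
    rcases lt_or_ge i w.length with hi | hi
    · rw [hx, prepend_of_lt _ _ _ hi, periodicWord_eq_prepend w, prepend_of_lt _ _ _ hi]
    · obtain ⟨j, rfl⟩ := Nat.exists_eq_add_of_le hi
      rw [hx, prepend_add, periodicWord_eq_prepend w, prepend_add, ih j (by omega)]

theorem phiPow_ne_nil (n : ℕ) : phiPow n ≠ [] :=
  List.length_pos_iff.mp ((Nat.zero_le n).trans_lt (lt_length_phiPow n))

theorem subst_periodicWord_phiPow (n : ℕ) :
    subst (periodicWord (phiPow n)) = periodicWord (phiPow (n + 1)) := by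
  refine eq_periodicWord (phiPow_ne_nil _) ?_
  conv_lhs => rw [periodicWord_eq_prepend (phiPow n), subst_prepend, ← phiPow_succ]

theorem periodicWord_phiPow_zero : periodicWord (phiPow 0) = fun _ => 1 := by
  funext k
  simp [periodicWord, phiPow, Nat.mod_one]

/-- `φ` fixes `φ^∞(1)` and carries each periodic word to the next, so the inequality propagates from
`10⋯ ≺ 111⋯`. -/
theorem phiInf_altLT_periodicWord (n : ℕ) : AltLT phiInf (periodicWord (phiPow n)) := by
  induction n with
  | zero =>
    rw [periodicWord_phiPow_zero]
    obtain ⟨h0, h1, -, -⟩ := phiInf_values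
    exact ⟨1, fun i hi => by rw [Nat.lt_one_iff.mp hi, h0], by simp [h1]⟩
  | succ n ih =>
    rw [← subst_phiInf, ← subst_periodicWord_phiPow]
    exact ih.image_subst phiInf_le_one (periodicWord_le_one _)

/-! ### Desubstitution -/

/-- Remove the first block, `1` or `100`, of a word in the image of `φ`. -/
def peel (x : ℕ → ℕ) : ℕ → ℕ := if x 1 = 1 then suffix 1 x else suffix 3 x

/-- The preimage under `φ` of a word that is a concatenation of blocks `1` and `100`. -/
def desubst (x : ℕ → ℕ) : ℕ → ℕ := fun i => if (peel^[i] x) 1 = 1 then 0 else 1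

theorem desubst_le_one (x : ℕ → ℕ) (i : ℕ) : desubst x i ≤ 1 := by
  unfold desubst; split_ifs <;> simp

theorem suffix_desubst (n : ℕ) (x : ℕ → ℕ) : suffix n (desubst x) = desubst (peel^[n] x) := by
  funext i
  simp only [suffix, desubst, ← Function.iterate_add_apply, add_comm n i]

theorem exists_suffix_eq_iterate_peel (n : ℕ) (x : ℕ → ℕ) : ∃ m, peel^[n] x = suffix m x := by
  induction n with
  | zero => exact ⟨0, (suffix_zero x).symm⟩
  | succ n ih =>
    obtain ⟨m, hm⟩ := ih
    rw [Function.iterate_succ_apply', hm, peel]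
    split_ifs
    · exact ⟨m + 1, suffix_suffix _ _ _⟩
    · exact ⟨m + 3, suffix_suffix _ _ _⟩

/-- Comparison with the prefix `1001` of `φ^∞(1)` forces each letter. So after a `1` comes either
another `1` or `001`: the word splits into blocks `1` and `100`, each followed by a `1`. -/
theorem head_of_phiInf_altLE {x : ℕ → ℕ} (hx : ∀ i, x i ≤ 1) (h : AltLE phiInf x) (h0 : x 0 = 1)
    (h1 : x 1 ≠ 1) : x 1 = 0 ∧ x 2 = 0 ∧ x 3 = 1 := by
  obtain ⟨p0, p1, p2, p3⟩ := phiInf_values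
  have e1 : x 1 = 0 := by have := hx 1; omega
  rcases altLE_iff_head_tail.mp h with h | ⟨-, h⟩
  · omega
  rcases altLE_iff_head_tail.mp h with h | ⟨-, h⟩
  · simp [suffix] at h; omega
  simp only [suffix_suffix] at h
  rcases altLE_iff_head_tail.mp h with h | ⟨e2, h⟩
  · simp [suffix] at h; omega
  simp only [suffix_suffix] at h
  simp [suffix] at e2
  refine ⟨e1, by omega, ?_⟩
  have h3 := h.head_le
  simp [suffix] at h3
  have := hx 3
  omega

theorem peel_zero {x : ℕ → ℕ} (hx : ∀ i, x i ≤ 1) (h : AltLE phiInf x) (h0 : x 0 = 1) :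
    peel x 0 = 1 := by
  unfold peel
  split_ifs with h1
  · exact h1
  · exact (head_of_phiInf_altLE hx h h0 h1).2.2

theorem subst_desubst {x : ℕ → ℕ} (hx : ∀ i, x i ≤ 1) (h : ∀ n, AltLE phiInf (suffix n x))
    (h0 : x 0 = 1) : subst (desubst x) = x := by
  funext n
  induction n using Nat.strong_induction_on generalizing x with
  | _ n ih =>
    have hp : AltLE phiInf x := by simpa [suffix_zero] using h 0
    obtain rfl | hn := Nat.eq_zero_or_pos n
    · rw [subst_zero, h0]
    have hpeel : ∀ m < n, subst (desubst (peel x)) m = peel x m := fun m hm => by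
      obtain ⟨k, hk⟩ := exists_suffix_eq_iterate_peel 1 x
      rw [Function.iterate_one] at hk
      refine ih m hm (fun i => ?_) (fun j => ?_) (peel_zero hx hp h0)
      · rw [hk]; exact hx _
      · rw [hk, suffix_suffix]; exact h _
    have htail : suffix 1 (desubst x) = desubst (peel x) := suffix_desubst 1 x
    by_cases h1 : x 1 = 1
    · have hd : desubst x 0 = 0 := by simp [desubst, h1]
      obtain ⟨m, rfl⟩ := Nat.exists_eq_add_of_le hn
      have e := congrFun (suffix_one_subst hd) m
      rw [htail, hpeel m (by omega), peel, if_pos h1] at e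
      exact e
    · have hd : desubst x 0 ≠ 0 := by simp [desubst, h1]
      obtain ⟨e1, e2, -⟩ := head_of_phiInf_altLE hx hp h0 h1
      rcases lt_or_ge n 3 with h3 | h3
      · have : n = 1 ∨ n = 2 := by omega
        rcases this with rfl | rfl
        · rw [subst_one hd, e1]
        · rw [subst_two hd, e2]
      · obtain ⟨m, rfl⟩ := Nat.exists_eq_add_of_le h3
        have e := congrFun (suffix_three_subst hd) m
        rw [htail, hpeel m (by omega), peel, if_neg h1] at e
        exact e

/-- Suffixes of the desubstituted word correspond to suffixes of `x` at block boundaries, and `φ`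
reflects the order. Applied with `u` the desubstituted word itself (Lyndon property) and with `u =
φ^∞(1)`. -/
theorem altLE_suffix_desubst {x u : ℕ → ℕ} (hx : ∀ i, x i ≤ 1)
    (h : ∀ n, AltLE phiInf (suffix n x)) (h0 : x 0 = 1) (hu : ∀ i, u i ≤ 1)
    (hux : ∀ n, AltLE (subst u) (suffix n x)) (n : ℕ) : AltLE u (suffix n (desubst x)) := by
  have h0' : ∀ m, peel^[m] x 0 = 1 := fun m => by
    induction m with
    | zero => exact h0
    | succ m ih =>
      rw [Function.iterate_succ_apply']
      obtain ⟨k, hk⟩ := exists_suffix_eq_iterate_peel m x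
      rw [hk] at ih ⊢
      exact peel_zero (fun i => hx _) (h k) ih
  obtain ⟨k, hk⟩ := exists_suffix_eq_iterate_peel n x
  have hsub : subst (desubst (suffix k x)) = suffix k x :=
    subst_desubst (fun i => hx _) (fun m => by rw [suffix_suffix]; exact h _) (hk ▸ h0' n)
  rw [suffix_desubst, hk, ← subst_altLE_subst hu (desubst_le_one _), hsub]
  exact hux k

theorem IsAltLyndon.le_head {d : ℕ → ℕ} (hd : IsAltLyndon d) (i : ℕ) : d i ≤ d 0 :=
  (hd i).head_le

theorem IsAltLyndon.eq_one_or_eq_subst {d : ℕ → ℕ} (hd : IsAltLyndon d) (hp : AltLE phiInf d)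
    (h0 : d 0 = 1) :
    d = (fun _ => 1) ∨ ∃ e, d = subst e ∧ IsAltLyndon e ∧ AltLE phiInf e ∧ e 0 = 1 := by
  have hb : ∀ i, d i ≤ 1 := fun i => h0 ▸ hd.le_head i
  have hps : ∀ n, AltLE phiInf (suffix n d) := fun n => hp.trans (hd n)
  by_cases h1 : d 1 = 1
  · left
    funext i
    induction i with
    | zero => exact h0
    | succ i ih =>
      -- Once `d` starts with `11`, a later `10` would give a suffix smaller than `d`.
      rcases altLE_iff_head_tail.mp (hd i) with h | ⟨-, h⟩
      · simp [suffix] at h; omega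
      · have h := h.head_le
        simp [suffix] at h
        have := hb (i + 1)
        omega
  · right
    have he := subst_desubst hb hps h0
    refine ⟨desubst d, he.symm, ?_, ?_, ?_⟩
    · refine altLE_suffix_desubst hb hps h0 (desubst_le_one d) fun n => ?_
      rw [he]; exact hd n
    · have := altLE_suffix_desubst hb hps h0 phiInf_le_one
        (fun n => by rw [subst_phiInf]; exact hps n) 0
      rwa [suffix_zero] at this
    · simp [desubst, h1]

theorem IsAltLyndon.classification {d : ℕ → ℕ} (hd : IsAltLyndon d) (hp : AltLE phiInf d) :
    d = (fun _ => 0) ∨ d = phiInf ∨ ∃ n : ℕ, d = periodicWord (phiPow n) := by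
  have hle : d 0 ≤ 1 := phiInf_values.1 ▸ hp.head_le
  obtain h0 | h0 : d 0 = 0 ∨ d 0 = 1 := by omega
  · left
    funext i
    have := hd.le_head i
    omega
  right
  by_cases hper : ∃ n, d = periodicWord (phiPow n)
  · exact Or.inr hper
  left
  -- With the periodic words excluded, the descent never reaches `111⋯`, so `d` has every `φⁿ(1)` as
  -- a prefix.
  have key : ∀ n, ∃ e, d = subst^[n] e ∧ IsAltLyndon e ∧ AltLE phiInf e ∧ e 0 = 1 := fun n => by
    induction n with
    | zero => exact ⟨d, rfl, hd, hp, h0⟩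
    | succ n ih =>
      obtain ⟨e, he, hl, hpe, h1⟩ := ih
      rcases hl.eq_one_or_eq_subst hpe h1 with rfl | ⟨e', rfl, h'⟩
      · refine absurd ⟨n, ?_⟩ hper
        rw [he, ← periodicWord_phiPow_zero]
        clear he
        induction n with
        | zero => rfl
        | succ n ih => rw [Function.iterate_succ_apply', ih, subst_periodicWord_phiPow]
      · exact ⟨e', he, h'⟩
  funext k
  obtain ⟨e, he, -, -, h1⟩ := key k
  have hpre : e = prepend [1] (suffix 1 e) :=
    eq_prepend (w := [1]) fun i hi => by
      obtain rfl : i = 0 := by simpa using hi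
      exact h1
  rw [he, hpre, iterate_subst_prepend, prepend_phiPow_apply le_rfl]

theorem phiInf_altLE_of_mem_list {d : ℕ → ℕ}
    (h : d = (fun _ => 0) ∨ d = phiInf ∨ ∃ n : ℕ, d = periodicWord (phiPow n)) :
    AltLE phiInf d := by
  rcases h with rfl | rfl | ⟨n, rfl⟩
  · exact altLE_iff_head_tail.mpr (Or.inl (by simp [phiInf_values.1]))
  · exact AltLE.refl _
  · exact Or.inr (phiInf_altLT_periodicWord n)

theorem AltLT.exists_altLT_iterate_subst {d : ℕ → ℕ} (h : AltLT d phiInf) :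
    ∃ n, AltLT d (subst^[n] fun k => (k + 1) % 2) := by
  obtain ⟨k, hk, hk'⟩ := h
  have hpre : (fun k => (k + 1) % 2) = prepend [1] (suffix 1 fun k => (k + 1) % 2) :=
    eq_prepend (w := [1]) fun i hi => by
      obtain rfl : i = 0 := by simpa using hi
      rfl
  have e : ∀ i ≤ k, (subst^[k] fun k => (k + 1) % 2) i = phiInf i := fun i hi => by
    rw [hpre, iterate_subst_prepend, prepend_phiPow_apply hi]
  -- The index `k` of the first difference also serves as the number of iterations, because `φ^k(1)`
  -- has more than `k` letters.
  exact ⟨k, k, fun i hi => by rw [e i hi.le, hk i hi], by rw [e k le_rfl]; exact hk'⟩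

theorem iterate_subst_le_one {x : ℕ → ℕ} (hx : ∀ i, x i ≤ 1) (n i : ℕ) : subst^[n] x i ≤ 1 := by
  cases n with
  | zero => exact hx i
  | succ n => rw [Function.iterate_succ_apply']; exact subst_le_one _ _

theorem iterate_subst_mem_lyndonSystem {d : ℕ → ℕ} {n : ℕ}
    (h : AltLT d (subst^[n] fun k => (k + 1) % 2)) {x : ℕ → ℕ} (hx : ∀ i, x i ≤ 1) :
    subst^[n] x ∈ lyndonSystem d := by
  have hu : ∀ i, (fun k => (k + 1) % 2) i ≤ 1 := fun i =>
    Nat.le_of_lt_succ (Nat.mod_lt _ two_pos)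
  have key : ∀ m, AltLE (subst^[n] fun k => (k + 1) % 2) (suffix m (subst^[n] x)) := by
    clear h
    induction n with
    | zero => exact fun m => altLE_alternating fun i => hx _
    | succ n ih =>
      simp only [Function.iterate_succ_apply']
      exact subst_altLE_suffix_subst (iterate_subst_le_one hu n) (iterate_subst_le_one hx n) ih
  have h0 : 1 ≤ d 0 := by
    refine le_trans ?_ (AltLE.head_le (Or.inr h))
    cases n with
    | zero => exact le_rfl
    | succ n => rw [Function.iterate_succ_apply', subst_zero]
  exact ⟨fun i => (iterate_subst_le_one hx n i).trans h0,
    fun m => AltLE.trans (Or.inr h) (key m)⟩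

/-! ### Language growth and entropy -/

theorem mem_lyndonSystem_self {d : ℕ → ℕ} (hd : IsAltLyndon d) : d ∈ lyndonSystem d :=
  ⟨hd.le_head, hd⟩

theorem suffix_mem_lyndonSystem {d x : ℕ → ℕ} (hx : x ∈ lyndonSystem d) (n : ℕ) :
    suffix n x ∈ lyndonSystem d :=
  ⟨fun _ => hx.1 _, fun m => by rw [suffix_suffix]; exact hx.2 _⟩

theorem lyndonSystem_mono {d e : ℕ → ℕ} (h : AltLE d e) : lyndonSystem e ⊆ lyndonSystem d :=
  fun _ hx => ⟨fun i => (hx.1 i).trans h.head_le, fun n => h.trans (hx.2 n)⟩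

theorem language_mono {M N : Set (ℕ → ℕ)} (h : M ⊆ N) (n : ℕ) : language M n ⊆ language N n :=
  fun _ ⟨x, hx, k, hk⟩ => ⟨x, h hx, k, hk⟩

theorem finite_language (d : ℕ → ℕ) (n : ℕ) : (language (lyndonSystem d) n).Finite := by
  refine (Set.Finite.pi' fun _ : Fin n => Set.finite_Iic (d 0)).subset ?_
  rintro w ⟨x, hx, k, hk⟩ i
  rw [hk]
  exact hx.1 _

theorem language_nonempty {M : Set (ℕ → ℕ)} (hM : M.Nonempty) (n : ℕ) : (language M n).Nonempty :=
  let ⟨x, hx⟩ := hM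
  ⟨fun i => x i, x, hx, 0, fun i => by rw [zero_add]⟩

theorem ncard_language_pos {d : ℕ → ℕ} (hM : (lyndonSystem d).Nonempty) (n : ℕ) :
    0 < (language (lyndonSystem d) n).ncard :=
  (Set.ncard_pos (finite_language d n)).mpr (language_nonempty hM n)

theorem ncard_language_add_le (d : ℕ → ℕ) (m n : ℕ) :
    (language (lyndonSystem d) (m + n)).ncard ≤
      (language (lyndonSystem d) m).ncard * (language (lyndonSystem d) n).ncard := by
  rw [← Set.ncard_prod]
  refine Set.ncard_le_ncard_of_injOn
    (fun w => (fun i => w (Fin.castAdd n i), fun i => w (Fin.natAdd m i))) ?_ ?_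
    ((finite_language d m).prod (finite_language d n))
  · rintro w ⟨x, hx, k, hk⟩
    exact ⟨⟨x, hx, k, fun i => hk _⟩, x, hx, k + m, fun i => by simp [hk, add_assoc]⟩
  · intro v _ w _ h
    simp only [Prod.mk.injEq] at h
    funext i
    refine Fin.addCases (fun j => congrFun h.1 j) (fun j => congrFun h.2 j) i

/-- Fekete's lemma: `H_n` is submultiplicative, and positive since the system is non-empty. -/
theorem tendsto_growth {d : ℕ → ℕ} (hM : (lyndonSystem d).Nonempty) :
    Filter.Tendsto (growth (lyndonSystem d)) Filter.atTop (nhds (entropy (lyndonSystem d))) := by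
  have hpos := ncard_language_pos hM
  have hsub : Subadditive fun n => Real.log ((language (lyndonSystem d) n).ncard : ℝ) := by
    intro m n
    rw [← Real.log_mul (by exact_mod_cast (hpos m).ne') (by exact_mod_cast (hpos n).ne')]
    exact Real.log_le_log (by exact_mod_cast hpos _) (by exact_mod_cast ncard_language_add_le d m n)
  have hlim := hsub.tendsto_lim ⟨0, by
    rintro _ ⟨n, rfl⟩
    exact div_nonneg (Real.log_natCast_nonneg _) (Nat.cast_nonneg _)⟩
  have hlim' : Filter.Tendsto (growth (lyndonSystem d)) Filter.atTop (nhds hsub.lim) := hlim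
  rw [entropy, hlim'.limUnder_eq]
  exact hlim'

theorem entropy_nonneg {d : ℕ → ℕ} (hM : (lyndonSystem d).Nonempty) :
    0 ≤ entropy (lyndonSystem d) :=
  ge_of_tendsto' (tendsto_growth hM) fun _ =>
    div_nonneg (Real.log_natCast_nonneg _) (Nat.cast_nonneg _)

theorem entropy_mono {d e : ℕ → ℕ} (hM : (lyndonSystem e).Nonempty) (h : AltLE d e) :
    entropy (lyndonSystem e) ≤ entropy (lyndonSystem d) := by
  have hsub := lyndonSystem_mono h
  refine le_of_tendsto_of_tendsto' (tendsto_growth hM) (tendsto_growth (hM.mono hsub)) fun n => ?_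
  refine div_le_div_of_nonneg_right (Real.log_le_log ?_ ?_) (Nat.cast_nonneg _)
  · exact_mod_cast ncard_language_pos hM n
  · exact_mod_cast Set.ncard_le_ncard (language_mono hsub n) (finite_language d n)

/-! ### Positive entropy below `φ^∞(1)` -/

/-- Blocks have at most 3 letters, and the second letter of the image reveals which block comes
first. -/
theorem eq_of_subst_eq {x y : ℕ → ℕ} (hx : ∀ i, x i ≤ 1) (hy : ∀ i, y i ≤ 1) (n : ℕ)
    (h : ∀ i < 3 * n, subst x i = subst y i) : ∀ i < n, x i = y i := by
  induction n generalizing x y with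
  | zero => exact fun i hi => absurd hi (Nat.not_lt_zero i)
  | succ n ih =>
    have hd : ∀ z : ℕ → ℕ, z 0 = 0 ↔ subst z 1 = 1 := fun z => by
      refine ⟨fun hz => ?_, fun hz => ?_⟩
      · have := congrFun (suffix_one_subst hz) 0
        rwa [subst_zero] at this
      · by_contra hz'
        rw [subst_one hz'] at hz
        exact zero_ne_one hz
    have h01 : x 0 = 0 ↔ y 0 = 0 := by rw [hd, hd, h 1 (by omega)]
    have h0 : x 0 = y 0 := by have := hx 0; have := hy 0; omega
    have htail : ∀ i < 3 * n, subst (suffix 1 x) i = subst (suffix 1 y) i := fun i hi => by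
      by_cases hz : x 0 = 0
      · rw [← suffix_one_subst hz, ← suffix_one_subst (h0 ▸ hz)]
        exact h _ (by omega)
      · rw [← suffix_three_subst hz, ← suffix_three_subst (h0 ▸ hz)]
        exact h _ (by omega)
    intro i hi
    cases i with
    | zero => exact h0
    | succ i =>
      have := ih (fun i => hx _) (fun i => hy _) htail i (by omega)
      simpa [suffix, add_comm] using this

theorem eq_of_iterate_subst_eq {x y : ℕ → ℕ} (hx : ∀ i, x i ≤ 1) (hy : ∀ i, y i ≤ 1) (k n : ℕ)
    (h : ∀ i < 3 ^ k * n, subst^[k] x i = subst^[k] y i) : ∀ i < n, x i = y i := by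
  induction k with
  | zero => simpa using h
  | succ k ih =>
    refine ih (eq_of_subst_eq (iterate_subst_le_one hx k) (iterate_subst_le_one hy k) _ ?_)
    rw [← mul_assoc, ← pow_succ']
    simpa only [Function.iterate_succ_apply'] using h

/-- A finite word extended by zeros. -/
def extend {n : ℕ} (u : Fin n → ℕ) : ℕ → ℕ := fun i => if h : i < n then u ⟨i, h⟩ else 0

theorem two_pow_le_ncard_language {d : ℕ → ℕ} {k : ℕ}
    (h : AltLT d (subst^[k] fun k => (k + 1) % 2)) (n : ℕ) :
    2 ^ n ≤ (language (lyndonSystem d) (3 ^ k * n)).ncard := by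
  have hbin : ∀ b : Fin n → Fin 2, ∀ i, extend (fun j => (b j : ℕ)) i ≤ 1 := fun b i => by
    unfold extend
    split_ifs
    · exact Nat.le_of_lt_succ (Fin.is_lt _)
    · exact zero_le_one
  have e : (Set.univ : Set (Fin n → Fin 2)).ncard = 2 ^ n := by
    simp [Set.ncard_univ]
  rw [← e]
  refine Set.ncard_le_ncard_of_injOn
    (fun b i => subst^[k] (extend fun j => (b j : ℕ)) i) ?_ ?_ (finite_language _ _)
  · intro b _
    exact ⟨_, iterate_subst_mem_lyndonSystem h (hbin b), 0, fun i => by rw [zero_add]⟩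
  · intro b _ c _ hbc
    funext j
    have := eq_of_iterate_subst_eq (hbin b) (hbin c) k n
      (fun i hi => congrFun hbc ⟨i, hi⟩) j j.2
    simp only [extend, j.2, dif_pos] at this
    exact Fin.ext this

theorem entropy_pos {d : ℕ → ℕ} (h : AltLT d phiInf) : 0 < entropy (lyndonSystem d) := by
  obtain ⟨k, hk⟩ := h.exists_altLT_iterate_subst
  have hM : (lyndonSystem d).Nonempty :=
    ⟨_, iterate_subst_mem_lyndonSystem hk (x := fun _ => 0) fun _ => zero_le_one⟩
  have hk3 : 0 < 3 ^ k := by positivity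
  -- The limit is known to exist, so it can be bounded along the lengths `3^k n`.
  have hsub := (tendsto_growth hM).comp (Filter.tendsto_id.const_mul_atTop' hk3)
  refine lt_of_lt_of_le (b := Real.log 2 / 3 ^ k) (by positivity) ?_
  refine ge_of_tendsto hsub ?_
  filter_upwards [Filter.eventually_ge_atTop 1] with n hn
  have hn' : (0 : ℝ) < n := by exact_mod_cast hn
  simp only [Function.comp_apply, id, growth]
  rw [div_le_div_iff₀ (by positivity) (by push_cast; positivity)]
  have hlog : n * Real.log 2 ≤ Real.log ((language (lyndonSystem d) (3 ^ k * n)).ncard : ℝ) := by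
    rw [← Real.log_pow]
    exact Real.log_le_log (by positivity) (by exact_mod_cast two_pow_le_ncard_language hk n)
  push_cast
  nlinarith [mul_le_mul_of_nonneg_right hlog (by positivity : (0 : ℝ) ≤ 3 ^ k)]

/-! ### Zero entropy at `φ^∞(1)` -/

/-- The word `0^k y`. -/
def zeros (k : ℕ) (y : ℕ → ℕ) : ℕ → ℕ := fun i => if i < k then 0 else y (i - k)

theorem exists_eq_zeros_subst {x : ℕ → ℕ} (hx : x ∈ lyndonSystem phiInf) (n : ℕ) :
    ∃ k ≤ n, ∃ y ∈ lyndonSystem phiInf, ∀ i < n, x i = zeros k (subst y) i := by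
  classical
  have p0 := phiInf_values.1
  by_cases h : ∃ i, i < n ∧ x i ≠ 0
  · obtain ⟨hkn, hk⟩ := Nat.find_spec h
    have hmin : ∀ i < Nat.find h, i < n → x i = 0 := fun i hi hin => by
      by_contra h'
      exact Nat.find_min h hi ⟨hin, h'⟩
    generalize Nat.find h = k at hkn hk hmin
    have hs := suffix_mem_lyndonSystem hx k
    have hb : ∀ i, suffix k x i ≤ 1 := fun i => p0 ▸ hs.1 i
    have h0 : suffix k x 0 = 1 := by have := hb 0; simp only [suffix, add_zero] at this ⊢; omega
    refine ⟨k, hkn.le, desubst (suffix k x), ⟨fun i => p0 ▸ desubst_le_one _ i, ?_⟩, fun i hi => ?_⟩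
    · exact altLE_suffix_desubst hb hs.2 h0 phiInf_le_one fun m => by
        rw [subst_phiInf]; exact hs.2 m
    · rw [subst_desubst hb hs.2 h0, zeros]
      split_ifs with hik
      · exact hmin i hik hi
      · simp only [suffix]
        congr 1
        omega
  -- The first `n` letters are all `0`: with `k = n` the choice of `y` is immaterial.
  · refine ⟨n, le_rfl, x, hx, fun i hi => ?_⟩
    rw [zeros, if_pos hi]
    by_contra h'
    exact h ⟨i, hi, h'⟩

theorem zeros_congr {x y : ℕ → ℕ} {n : ℕ} (h : ∀ i < n, x i = y i) (k : ℕ) :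
    ∀ i < n, zeros k x i = zeros k y i := by
  intro i hi
  unfold zeros
  split_ifs
  · rfl
  · exact h _ (by omega)

theorem subst_congr {x y : ℕ → ℕ} {n : ℕ} (h : ∀ i < n, x i = y i) :
    ∀ i < n, subst x i = subst y i := by
  induction n generalizing x y with
  | zero => exact fun i hi => absurd hi (Nat.not_lt_zero i)
  | succ n ih =>
    intro i hi
    have h0 := h 0 (Nat.succ_pos n)
    have htail := ih (x := suffix 1 x) (y := suffix 1 y) fun i hi => h _ (by omega)
    rcases Nat.eq_zero_or_pos i with rfl | hpos
    · rw [subst_zero, subst_zero]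
    by_cases hz : x 0 = 0
    · obtain ⟨j, rfl⟩ := Nat.exists_eq_add_of_le hpos
      have := htail j (by omega)
      rwa [← suffix_one_subst hz, ← suffix_one_subst (h0 ▸ hz)] at this
    · rcases lt_or_ge i 3 with h3 | h3
      · have : i = 1 ∨ i = 2 := by omega
        rcases this with rfl | rfl
        · rw [subst_one hz, subst_one (h0 ▸ hz)]
        · rw [subst_two hz, subst_two (h0 ▸ hz)]
      · obtain ⟨j, rfl⟩ := Nat.exists_eq_add_of_le h3
        have := htail j (by omega)
        rwa [← suffix_three_subst hz, ← suffix_three_subst (h0 ▸ hz)] at this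

theorem eq_of_suffix_three {x y : ℕ → ℕ} {n : ℕ} (h0 : x 0 = y 0) (h1 : x 1 = y 1)
    (h2 : x 2 = y 2) (h : ∀ i < n, suffix 3 x i = suffix 3 y i) : ∀ i < n + 3, x i = y i := by
  intro i hi
  match i with
  | 0 => exact h0
  | 1 => exact h1
  | 2 => exact h2
  | i + 3 => simpa [suffix, add_comm] using h i (by omega)

/-- `φ²(0) = 100` and `φ²(1) = 10011` have at least 3 letters. One application of `φ` would not do,
as `φ(0) = 1` gives no expansion. -/
theorem subst_subst_congr {x y : ℕ → ℕ} {n : ℕ} (h : ∀ i < n, x i = y i) :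
    ∀ i < 3 * n, subst (subst x) i = subst (subst y) i := by
  induction n generalizing x y with
  | zero => exact fun i hi => absurd hi (Nat.not_lt_zero i)
  | succ n ih =>
    have hs : ∀ z : ℕ → ℕ, subst z 0 ≠ 0 := fun z => by rw [subst_zero]; exact one_ne_zero
    have h0 := h 0 (Nat.succ_pos n)
    have htail := ih (x := suffix 1 x) (y := suffix 1 y) fun i hi => h _ (by omega)
    refine eq_of_suffix_three (n := 3 * n) (by simp only [subst_zero])
      (by rw [subst_one (hs _), subst_one (hs _)])
      (by rw [subst_two (hs _), subst_two (hs _)]) ?_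
    rw [suffix_three_subst (hs _), suffix_three_subst (hs _)]
    by_cases hz : x 0 = 0
    · rwa [suffix_one_subst hz, suffix_one_subst (h0 ▸ hz)]
    · have e : ∀ z : ℕ → ℕ, z 0 ≠ 0 → subst (suffix 1 (subst z)) 0 = 1 ∧
          subst (suffix 1 (subst z)) 1 = 1 ∧
          ∀ i, subst (suffix 1 (subst z)) (i + 2) = subst (subst (suffix 1 z)) i := fun z hz => by
        have a : suffix 1 (subst z) 0 = 0 := subst_one hz
        have b : suffix 2 (subst z) 0 = 0 := subst_two hz
        have a' := suffix_one_subst a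
        have b' := suffix_one_subst b
        rw [suffix_suffix] at a' b'
        have c : ∀ i, subst (suffix 1 (subst z)) (i + 1) = subst (suffix 2 (subst z)) i :=
          fun i => by rw [← a', suffix, add_comm]
        refine ⟨subst_zero _, by rw [c 0, subst_zero], fun i => ?_⟩
        rw [c (i + 1), ← suffix_three_subst hz, ← b', suffix, add_comm]
      obtain ⟨a0, a1, a2⟩ := e x hz
      obtain ⟨b0, b1, b2⟩ := e y (h0 ▸ hz)
      intro i hi
      match i with
      | 0 => rw [a0, b0]
      | 1 => rw [a1, b1]
      | i + 2 => rw [a2, b2]; exact htail i (by omega)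

/-- `φ(0^k φ(x)) = 1^k φ²(x)`: the extra prefix only pushes the agreement further out. -/
theorem subst_zeros_subst_congr {x y : ℕ → ℕ} {n : ℕ} (h : ∀ i < n, x i = y i) (k : ℕ) :
    ∀ i < 3 * n, subst (zeros k (subst x)) i = subst (zeros k (subst y)) i := by
  induction k with
  | zero =>
    have e : ∀ z, zeros 0 z = z := fun z => by funext i; simp [zeros]
    simpa only [e] using subst_subst_congr h
  | succ k ih =>
    have e0 : ∀ z, zeros (k + 1) z 0 = 0 := fun z => by simp [zeros]
    have e1 : ∀ z, suffix 1 (zeros (k + 1) z) = zeros k z := fun z => by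
      funext i
      simp [zeros, suffix, add_comm 1 i]
    intro i hi
    cases i with
    | zero => simp only [subst_zero]
    | succ i =>
      have := ih i (by omega)
      rwa [← e1, ← e1, ← suffix_one_subst (e0 _), ← suffix_one_subst (e0 _), suffix, suffix,
        add_comm 1 i] at this

/-- A block of length `3n` is a prefix of `0^j φ(0^l φ(z))`, hence determined by `j, l ≤ 3n` and the
first `n` letters of `z`. -/
theorem ncard_language_phiInf_le (n : ℕ) :
    (language (lyndonSystem phiInf) (3 * n)).ncard ≤
      (3 * n + 1) ^ 2 * (language (lyndonSystem phiInf) n).ncard := by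
  have hfin : ((Set.Iic (3 * n) ×ˢ Set.Iic (3 * n)) ×ˢ language (lyndonSystem phiInf) n).Finite :=
    ((Set.finite_Iic _).prod (Set.finite_Iic _)).prod (finite_language _ _)
  have hcard : ((Set.Iic (3 * n) ×ˢ Set.Iic (3 * n)) ×ˢ language (lyndonSystem phiInf) n).ncard =
      (3 * n + 1) ^ 2 * (language (lyndonSystem phiInf) n).ncard := by
    rw [Set.ncard_prod, Set.ncard_prod, Set.ncard_eq_toFinset_card' (Set.Iic (3 * n))]
    simp [sq]
  rw [← hcard]
  refine (Set.ncard_le_ncard ?_ (hfin.image fun p (i : Fin (3 * n)) =>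
    zeros p.1.1 (subst (zeros p.1.2 (subst (extend p.2)))) i)).trans (Set.ncard_image_le hfin)
  rintro w ⟨x, hx, m, hm⟩
  obtain ⟨j, hj, y, hy, hxy⟩ := exists_eq_zeros_subst (suffix_mem_lyndonSystem hx m) (3 * n)
  obtain ⟨l, hl, z, hz, hyz⟩ := exists_eq_zeros_subst hy (3 * n)
  refine ⟨((j, l), fun i => z i), ⟨⟨hj, hl⟩, z, hz, 0, fun i => by rw [zero_add]⟩, ?_⟩
  funext i
  have hext : ∀ i < n, extend (fun i : Fin n => z i) i = z i := fun i hi => by simp [extend, hi]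
  have hstep : ∀ i < 3 * n, subst (zeros l (subst (extend fun i : Fin n => z i))) i = subst y i :=
    fun i hi => (subst_zeros_subst_congr hext l i hi).trans (subst_congr hyz i hi).symm
  have := (zeros_congr hstep j i i.2).trans (hxy i i.2).symm
  rw [hm]
  exact this

theorem entropy_phiInf : entropy (lyndonSystem phiInf) = 0 := by
  have hM : (lyndonSystem phiInf).Nonempty :=
    ⟨fun _ => 0, fun _ => Nat.zero_le _, fun _ =>
      altLE_iff_head_tail.mpr (Or.inl (by simp [suffix, phiInf_values.1]))⟩
  refine le_antisymm ?_ (entropy_nonneg hM)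
  have hgrowth := tendsto_growth hM
  have hcast : Filter.Tendsto (fun n : ℕ => 3 * (n : ℝ) + 1) Filter.atTop Filter.atTop :=
    Filter.tendsto_atTop_add_const_right _ _
      (tendsto_natCast_atTop_atTop.const_mul_atTop (by norm_num))
  -- The constants `1, -1` turn the denominator at `3n + 1` into `3n`, so that `2 log(3n+1) / (3n) →
  -- 0`.
  have hlog := ((Real.tendsto_pow_log_div_mul_add_atTop 1 (-1) 1 one_ne_zero).comp hcast).const_mul 2
  have hle := le_of_tendsto_of_tendsto
    (hgrowth.comp (Filter.tendsto_id.const_mul_atTop' (by norm_num : 0 < 3)))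
    (hlog.add (hgrowth.div_const 3)) ?_
  · linarith
  filter_upwards [Filter.eventually_ge_atTop 1] with n hn
  have hn' : (0 : ℝ) < n := by exact_mod_cast hn
  have hpos : (0 : ℝ) < (language (lyndonSystem phiInf) n).ncard := by
    exact_mod_cast ncard_language_pos hM n
  have hkey : Real.log ((language (lyndonSystem phiInf) (3 * n)).ncard : ℝ) ≤
      2 * Real.log (3 * n + 1) + Real.log ((language (lyndonSystem phiInf) n).ncard : ℝ) := by
    have e : 2 * Real.log (3 * (n : ℝ) + 1) = Real.log ((3 * (n : ℝ) + 1) ^ 2) := by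
      rw [Real.log_pow]; norm_num
    rw [e, ← Real.log_mul (by positivity) hpos.ne']
    refine Real.log_le_log ?_ (by exact_mod_cast ncard_language_phiInf_le n)
    exact_mod_cast ncard_language_pos hM (3 * n)
  simp only [Function.comp_apply, id, growth]
  calc Real.log ((language (lyndonSystem phiInf) (3 * n)).ncard : ℝ) / ((3 * n : ℕ) : ℝ)
      ≤ (2 * Real.log (3 * n + 1) + Real.log ((language (lyndonSystem phiInf) n).ncard : ℝ)) /
          ((3 * n : ℕ) : ℝ) := div_le_div_of_nonneg_right hkey (Nat.cast_nonneg _)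
    _ = _ := by
      push_cast
      have : 1 * (3 * (n : ℝ) + 1) + -1 = 3 * n := by ring
      rw [this]
      field_simp

end AltLyndon

theorem theorem1 (d : ℕ → ℕ) (hd : AltLyndon.IsAltLyndon d) :
    -- the limit that defines the entropy exists
    Filter.Tendsto (AltLyndon.growth (AltLyndon.lyndonSystem d)) Filter.atTop
      (nhds (AltLyndon.entropy (AltLyndon.lyndonSystem d))) ∧
    -- (a)
    (0 < AltLyndon.entropy (AltLyndon.lyndonSystem d) ↔ AltLyndon.AltLT d AltLyndon.phiInf) ∧
    -- (b)
    (AltLyndon.entropy (AltLyndon.lyndonSystem d) = 0 ↔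
      d = (fun _ => 0) ∨ d = AltLyndon.phiInf ∨
        ∃ n : ℕ, d = AltLyndon.periodicWord (AltLyndon.phiPow n)) := by
  have hM : (AltLyndon.lyndonSystem d).Nonempty := ⟨d, AltLyndon.mem_lyndonSystem_self hd⟩
  have hzero : AltLyndon.AltLE AltLyndon.phiInf d →
      AltLyndon.entropy (AltLyndon.lyndonSystem d) = 0 := fun h =>
    le_antisymm (AltLyndon.entropy_phiInf ▸ AltLyndon.entropy_mono hM h)
      (AltLyndon.entropy_nonneg hM)
  refine ⟨AltLyndon.tendsto_growth hM, ⟨fun h => ?_, AltLyndon.entropy_pos⟩, fun h => ?_,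
    fun h => hzero (AltLyndon.phiInf_altLE_of_mem_list h)⟩
  · by_contra h'
    exact h.ne' (hzero (AltLyndon.altLE_iff_not_altLT.mpr h'))
  · refine hd.classification (AltLyndon.altLE_iff_not_altLT.mpr fun h' => ?_)
    exact (AltLyndon.entropy_pos h').ne' h
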